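/- A domain in $\mathbb C$ is a nonempty connected open set. For a domain $G\subsetneq\mathbb C$ let $H(G)$ be the algebra of holomorphic functions $G\to\mathbb C$; $\partial G$ and $\overline G$ denote the boundary and the closure of $G$ in $\mathbb C$. - $H_e(G)$ is the set of all $f\in H(G)$ for which there do not exist domains $G_1,G_2\subset\mathbb C$ and $\widetilde f\in H(G_1)$ with $G_2\subset G\cap G_1$, $G_1\not\subset G$ and $\widetilde f=f$ on $G_2$. - $H_{we}(G)$ is the set of all $f\in H(G)$ that have no holomorphic extension to any domain in $\mathbb C$ strictly containing $G$. - $A^1(G)$ (respectively $A^\infty(G)$) is the set of all $f\in H(G)$ such that $f$ and $f'$ (respectively $f^{(j)}$ for every $j\ge 0$) extend continuously to $\overline G$. - $G$ is regular if $G$ equals the interior of $\overline G$, and $G$ is a Jordan domain if its boundary in the Riemann sphere $\mathbb C\cup\{\infty\}$ is homeomorphic to a circle. - A subset $S$ of a commutative complex algebra is strongly $\mathfrak c$-algebrable if there is an algebra $M$ (not necessarily unital) with $M\setminus\{0\}\subset S$ that is generated by a set $B$ of cardinality $\mathfrak c$ (the cardinality of the continuum) which is free, i.e. $P(f_1,\dots,f_N)\neq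 0$ for all $N\in\mathbb N$, all distinct $f_1,\dots,f_N\in B$ and every nonzero complex polynomial $P$ in $N$ variables without constant term. **Theorem.** Let $G\subsetneq\mathbb C$ be a domain. (a) Suppose that $\partial G$ has no isolated points, and let $X\subset A^1(G)$ be an algebra of functions (under pointwise operations, not necessarily unital) that is stable under composition with entire functions: if $f\in X$ and $\varphi:\mathbb C\to\mathbb C$ is entire, then $\varphi\circ f\in X$. Then $H_{we}(G)\cap X$ is either empty or strongly $\mathfrak c$-algebrable. (b) If $G$ is regular, then $H_{we}(G)\cap A^\infty(G)$ is strongly $\mathfrak c$-algebrable. If $G$ is a Jordan domain, then $H_e(G)\cap A^\infty(G)$ is strongly $\mathfrak c$-algebrable. -/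

import Mathlib

open scoped Cardinal

/-- A domain in `ℂ`: a nonempty connected open set. -/
def IsDomainC (G : Set ℂ) : Prop := IsOpen G ∧ IsConnected G

/-- Extension by zero to `ℂ` of a function on `G`; only its values near points of the open set
`G` are ever used. -/
noncomputable def zeroExt {G : Set ℂ} (f : G → ℂ) : ℂ → ℂ :=
  Function.extend Subtype.val f 0

/-- `H(G)`: the holomorphic functions `G → ℂ`. -/
def holo (G : Set ℂ) : Set (G → ℂ) :=
  {f | DifferentiableOn ℂ (zeroExt f) G}

/-- `H_e(G)`: the functions holomorphic exactly on `G`, i.e. those for which there are no domains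
`G₁, G₂` with `G₂ ⊆ G ∩ G₁`, `G₁ ⊄ G`, and no holomorphic function on `G₁` which coincides with
`f` on `G₂`. -/
def holoExact (G : Set ℂ) : Set (G → ℂ) :=
  {f | f ∈ holo G ∧
    ¬ ∃ G₁ G₂ : Set ℂ, IsDomainC G₁ ∧ IsDomainC G₂ ∧ G₂ ⊆ G ∩ G₁ ∧ ¬ G₁ ⊆ G ∧
      ∃ F ∈ holo G₁, ∀ (z : ℂ) (hz : z ∈ G) (hz₁ : z ∈ G₁), z ∈ G₂ → F ⟨z, hz₁⟩ = f ⟨z, hz⟩}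

/-- `H_we(G)`: the functions holomorphic weakly exactly on `G`, i.e. those with no holomorphic
extension to a domain strictly containing `G`. -/
def holoWeaklyExact (G : Set ℂ) : Set (G → ℂ) :=
  {f | f ∈ holo G ∧
    ¬ ∃ D : Set ℂ, IsDomainC D ∧ G ⊂ D ∧
      ∃ F ∈ holo D, ∀ (z : ℂ) (hz : z ∈ G) (hzD : z ∈ D), F ⟨z, hzD⟩ = f ⟨z, hz⟩}

/-- `A^m(G)` for `m ∈ ℕ ∪ {∞}`: the holomorphic functions on `G` whose derivatives of all finite
orders `j ≤ m` have a continuous extension to the closure of `G` in `ℂ`. -/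
def boundaryRegular (m : ℕ∞) (G : Set ℂ) : Set (G → ℂ) :=
  {f | f ∈ holo G ∧ ∀ j : ℕ, (j : ℕ∞) ≤ m →
    ∃ g : ℂ → ℂ, ContinuousOn g (closure G) ∧ ∀ z ∈ G, g z = iteratedDeriv j (zeroExt f) z}

/-- `G` is regular: it is the interior of its closure. -/
def IsRegularDomain (G : Set ℂ) : Prop := IsDomainC G ∧ G = interior (closure G)

/-- `G` is a Jordan domain: its boundary in the Riemann sphere `ℂ ∪ {∞}` is homeomorphic to a
circle. -/
def IsJordanDomain (G : Set ℂ) : Prop :=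
  IsDomainC G ∧
    Nonempty (Circle ≃ₜ (frontier ((fun z : ℂ => (z : OnePoint ℂ)) '' G) : Set (OnePoint ℂ)))

/-- `S` is strongly `α`-algebrable: `S ∪ {0}` contains a (not necessarily unital) algebra freely
generated, as a commutative algebra, by a set `B` of cardinality `α`; free means that no nonzero
polynomial without constant term vanishes at distinct elements of `B`. -/
def StronglyAlgebrable {R : Type*} [CommRing R] [Algebra ℂ R] (α : Cardinal) (S : Set R) : Prop :=
  ∃ (M : NonUnitalSubalgebra ℂ R) (B : Set R),
    Cardinal.mk B = α ∧
    NonUnitalAlgebra.adjoin ℂ B = M ∧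
    (∀ P : MvPolynomial B ℂ, P ≠ 0 → MvPolynomial.constantCoeff P = 0 →
      MvPolynomial.aeval (fun b : B => (b : R)) P ≠ 0) ∧
    (M : Set R) \ {0} ⊆ S

/-!
# Algebras of functions that are holomorphic exactly on a plane domain

*Free generators.* If `f` is a function such that `φ ∘ f ∈ S` for every nonconstant entire `φ`, then
the functions `exp (β f)`, with `β` in a Hamel basis of `ℝ` over `ℚ`, freely generate an algebra in
`S ∪ {0}`: a polynomial without constant term in them is `φ ∘ f` with `φ` an exponential sum, and
`φ` is not constant because distinct characters are linearly independent
(`stronglyAlgebrable_of_comp_mem`). So everything reduces to one good `f` and to the stability of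
nonextendability under `f ↦ φ ∘ f`.

*Stability* (`exists_local_extension`). Let `u` be `C¹` up to the boundary of a domain `C` and let
`φ ∘ u` extend to a holomorphic `F` on a larger domain `D`. If `φ' (u z₀) ≠ 0` at some `z₀` in
`∂C ∩ D`, a local inverse of `φ` composed with `F` extends `u` near `z₀`. Otherwise `F' = (φ' ∘ u) u'`
vanishes on `∂C ∩ D`; when this set has no isolated points, `F` is constant, hence so is `u`. For
weak exactness `C = G`. For exactness `C` is a component of `G ∩ G₁`; isolated points of `∂C` in
`G₁` would lie in the interior of the closure of `G`, which is `G` when `G` is regular.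

*Existence* (`exists_boundaryRegular_taylor_unbounded`). For regular `G`, sums `∑ aₙ cₙ / (z - wₙ)`
with poles dense in the exterior and rapidly decreasing weights `cₙ` are smooth up to the boundary.
By Baire's theorem in `[0, 1]^ℕ` some choice of `a` violates all Cauchy estimates on discs that are
centred in a dense subset of `G` and reach the exterior, so there is no extension across any
boundary point. Thus the assertion on exactness holds for all regular domains other than `ℂ`.

*Jordan domains are regular* (`IsJordanDomain.isRegularDomain`). The part of the Jordan curve theorem
needed is that no boundary point `p` is interior to the closure of `G`. Split the curve into two
arcs from `q` to `p`. Off each arc the cross ratio with zero `p` and pole `q` has a continuous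
logarithm, by homotopy lifting along the arc. On `G` the two logarithms differ by a constant, so if
a neighbourhood of `p` lies in the closure of `G` they glue to a logarithm of `z - p` on a punctured
disc, which is impossible.
-/

open Filter Topology Metric

/-! ### Free algebras of exponential sums -/

/-- To find a free algebra inside `S ∪ {0}` it suffices to exhibit a family all of whose nonzero
polynomial expressions without constant term lie in `S`: since `0 ∉ S`, such a family is
automatically injective and free. -/
theorem exists_free_generators_of_family {R ι : Type*} [CommRing R] [Algebra ℂ R] {S : Set R}
    (h0 : (0 : R) ∉ S) (b : ι → R)
    (hb : ∀ P : MvPolynomial ι ℂ, P ≠ 0 → MvPolynomial.constantCoeff P = 0 →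
      MvPolynomial.aeval b P ∈ S) :
    ∃ B : Set R, Nonempty (ι ≃ B) ∧
    (∀ P : MvPolynomial B ℂ, P ≠ 0 → MvPolynomial.constantCoeff P = 0 →
      MvPolynomial.aeval (fun b : B => (b : R)) P ≠ 0) ∧
    (NonUnitalAlgebra.adjoin ℂ B : Set R) \ {0} ⊆ S := by
  have hinj : Function.Injective b := by
    intro i j hij
    by_contra hne
    have h := hb (MvPolynomial.X i - MvPolynomial.X j)
      (fun h => hne (MvPolynomial.X_injective (sub_eq_zero.1 h))) (by simp)
    exact h0 (by simpa [hij] using h)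
  let e : ι ≃ Set.range b := Equiv.ofInjective b hinj
  refine ⟨Set.range b, ⟨e⟩, ?_, ?_⟩
  · intro P hP hP0 hzero
    have key := hb (MvPolynomial.rename e.symm P)
      (fun h => hP (MvPolynomial.rename_injective _ e.symm.injective (by simpa using h)))
      (by simpa [MvPolynomial.constantCoeff_rename] using hP0)
    have hcomp : b ∘ e.symm = fun x : Set.range b => (x : R) := by
      funext x
      exact Equiv.apply_ofInjective_symm hinj x
    rw [MvPolynomial.aeval_rename, hcomp, hzero] at key
    exact h0 key
  · rintro x ⟨hx, hx0⟩
    have hpoly : ∃ P : MvPolynomial ι ℂ, MvPolynomial.constantCoeff P = 0 ∧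
        MvPolynomial.aeval b P = x := by
      refine NonUnitalAlgebra.adjoin_induction
        (p := fun x _ => ∃ P : MvPolynomial ι ℂ, MvPolynomial.constantCoeff P = 0 ∧
        MvPolynomial.aeval b P = x) ?_ ?_ ?_ ?_ ?_ hx
      · rintro _ ⟨i, rfl⟩
        exact ⟨MvPolynomial.X i, by simp, by simp⟩
      · rintro _ _ _ _ ⟨P, hP, rfl⟩ ⟨Q, hQ, rfl⟩
        exact ⟨P + Q, by simp [hP, hQ], by simp⟩
      · exact ⟨0, by simp, by simp⟩
      · rintro _ _ _ _ ⟨P, hP, rfl⟩ ⟨Q, hQ, rfl⟩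
        exact ⟨P * Q, by simp [hP], by simp⟩
      · rintro c _ _ ⟨P, hP, rfl⟩
        refine ⟨c • P, ?_, by simp⟩
        rw [MvPolynomial.smul_eq_C_mul, map_mul, hP, mul_zero]
    obtain ⟨P, hP, rfl⟩ := hpoly
    exact hb P (by rintro rfl; simp at hx0) hP

/-- The exponent `∑ mᵢ βᵢ` attached to a monomial `m` when the variables are replaced by the
exponentials `exp (βᵢ z)`. -/
noncomputable def expWeight {ι : Type*} (β : ι → ℝ) (m : ι →₀ ℕ) : ℂ :=
  ((Finsupp.linearCombination ℕ β m : ℝ) : ℂ)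

/-- The exponential sum obtained from a polynomial by substituting `exp (βᵢ z)` for the `i`-th
variable. -/
noncomputable def expSum {ι : Type*} (β : ι → ℝ) (P : MvPolynomial ι ℂ) (z : ℂ) : ℂ :=
  ∑ m ∈ P.support, P.coeff m * Complex.exp (expWeight β m * z)

theorem differentiable_expSum {ι : Type*} (β : ι → ℝ) (P : MvPolynomial ι ℂ) :
    Differentiable ℂ (expSum β P) := by
  unfold expSum
  fun_prop

theorem aeval_exp_comp {ι α : Type*} (β : ι → ℝ) (f : α → ℂ) (P : MvPolynomial ι ℂ) :
    MvPolynomial.aeval (fun i x => Complex.exp (β i * f x)) P = expSum β P ∘ f := by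
  rw [MvPolynomial.aeval_def, MvPolynomial.eval₂_eq]
  funext x
  simp only [Finset.sum_apply, Pi.mul_apply, Finset.prod_apply, Pi.pow_apply, Function.comp,
    expSum, expWeight]
  refine Finset.sum_congr rfl fun m _ => ?_
  congr 1
  rw [Finsupp.linearCombination_apply, Finsupp.sum]
  push_cast
  rw [Finset.sum_mul, Complex.exp_sum]
  refine Finset.prod_congr rfl fun i _ => ?_
  rw [← Complex.exp_nat_mul]
  congr 1
  simp only [nsmul_eq_mul]
  ring

/-- The character `z ↦ exp (a z)` of the additive group of `ℂ`. -/
noncomputable def expCharacter (a : ℂ) : Multiplicative ℂ →* ℂ where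
  toFun z := Complex.exp (a * z.toAdd)
  map_one' := by simp
  map_mul' x y := by simp [mul_add, Complex.exp_add]

theorem expCharacter_injective : Function.Injective expCharacter := by
  intro a b hab
  have hfun : (fun z : ℂ => Complex.exp (a * z)) = fun z => Complex.exp (b * z) := by
    funext z
    exact congrArg (fun χ => χ (Multiplicative.ofAdd z)) hab
  have hd : ∀ c : ℂ, HasDerivAt (fun z : ℂ => Complex.exp (c * z)) c 0 := by
    intro c
    simpa using ((hasDerivAt_id (0 : ℂ)).const_mul c).cexp
  exact (hd a).unique (hfun ▸ hd b)

/-- An exponential sum with `ℚ`-linearly independent frequencies coming from a nonzero polynomial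
without constant term is not constant: distinct monomials have distinct nonzero weights, and
distinct characters are linearly independent. -/
theorem expSum_not_const {ι : Type*} {β : ι → ℝ} (hβ : LinearIndependent ℚ β)
    {P : MvPolynomial ι ℂ} (hP : P ≠ 0) (hP0 : MvPolynomial.constantCoeff P = 0) :
    ¬ ∃ c, ∀ z, expSum β P z = c := by
  classical
  rintro ⟨c, hc⟩
  have hℕ : LinearIndependent ℕ β :=
    hβ.restrict_scalars (fun a b h => by simpa using h)
  have hw : Function.Injective (expWeight β) := fun m m' h =>
    hℕ (Complex.ofReal_injective h)
  have hlin : LinearIndependent ℂ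
      (fun m : ι →₀ ℕ => (expCharacter (expWeight β m) : Multiplicative ℂ → ℂ)) :=
    (linearIndependent_monoidHom (Multiplicative ℂ) ℂ).comp _ (expCharacter_injective.comp hw)
  have h0 : P.coeff 0 = 0 := by simpa [MvPolynomial.constantCoeff_eq] using hP0
  have hw0 : expWeight β 0 = 0 := by simp [expWeight]
  have hcoeff := linearIndependent_iff'.1 hlin (insert 0 P.support)
    (fun m => if m = 0 then -c else P.coeff m) (by
      rw [Finset.sum_insert (by simp [h0])]
      funext z
      have hz := hc z.toAdd
      simp only [expSum] at hz
      have : ∑ m ∈ P.support, (if m = 0 then -c else P.coeff m) *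
          Complex.exp (expWeight β m * z.toAdd) = c := by
        rw [← hz]
        refine Finset.sum_congr rfl fun m hm => ?_
        rw [if_neg]
        rintro rfl
        exact (MvPolynomial.mem_support_iff.1 hm) h0
      have hχ : ∀ m, expCharacter (expWeight β m) z =
          Complex.exp (expWeight β m * z.toAdd) := fun _ => rfl
      simp only [Pi.add_apply, Finset.sum_apply, Pi.smul_apply, smul_eq_mul, hχ, this]
      simp [hw0])
  refine hP (MvPolynomial.ext _ _ fun m => ?_)
  rw [MvPolynomial.coeff_zero]
  by_cases hm : m = 0
  · rw [hm, h0]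
  by_cases hmP : m ∈ P.support
  · simpa [hm] using hcoeff m (Finset.mem_insert_of_mem hmP)
  · simpa using hmP

/-- If every composition `φ ∘ f` with a nonconstant entire `φ` lies in `S`, then the exponentials
`exp (β f)`, with `β` running through a Hamel basis of `ℝ` over `ℚ`, are free generators of an
algebra contained in `S ∪ {0}`. -/
theorem stronglyAlgebrable_of_comp_mem {α : Type} {S : Set (α → ℂ)} (h0 : (0 : α → ℂ) ∉ S)
    (f : α → ℂ)
    (hf : ∀ φ : ℂ → ℂ, Differentiable ℂ φ → (¬ ∃ c, ∀ z, φ z = c) → φ ∘ f ∈ S) :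
    StronglyAlgebrable 𝔠 S := by
  let b := Module.Basis.ofVectorSpace ℚ ℝ
  obtain ⟨B, ⟨e⟩, hfree, hsub⟩ := exists_free_generators_of_family h0
    (fun i x => Complex.exp (b i * f x)) (fun P hP hP0 => by
      rw [aeval_exp_comp]
      exact hf _ (differentiable_expSum _ P) (expSum_not_const b.linearIndependent hP hP0))
  refine ⟨_, B, ?_, rfl, hfree, hsub⟩
  rw [← Cardinal.mk_congr e, b.mk_eq_rank'', Real.rank_rat_real]

/-! ### Local extension across the boundary -/

theorem exists_local_inverse {φ : ℂ → ℂ} (hφ : Differentiable ℂ φ) {a : ℂ} (ha : deriv φ a ≠ 0) :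
    ∃ ψ : ℂ → ℂ, (∀ᶠ w in 𝓝 (φ a), DifferentiableAt ℂ ψ w) ∧ ∀ᶠ z in 𝓝 a, ψ (φ z) = z := by
  have hc : ContDiffAt ℂ 1 φ a := hφ.contDiff.contDiffAt
  let e : ℂ ≃L[ℂ] ℂ := ContinuousLinearEquiv.unitsEquivAut ℂ (Units.mk0 _ ha)
  have hd : HasFDerivAt φ (e : ℂ →L[ℂ] ℂ) a := by
    have := (hφ a).hasDerivAt.hasFDerivAt
    convert! this using 1
  refine ⟨hc.localInverse hd one_ne_zero, ?_, ?_⟩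
  · filter_upwards [(hc.to_localInverse hd one_ne_zero).eventually (by simp)] with w hw
    exact hw.differentiableAt one_ne_zero
  · exact (hc.toOpenPartialHomeomorph φ hd one_ne_zero).eventually_left_inverse
      (hc.mem_toOpenPartialHomeomorph_source hd one_ne_zero)

theorem frontier_inter_nonempty_of_not_subset {C D : Set ℂ} (hC : IsOpen C)
    (hD : IsPreconnected D) (hmeet : (D ∩ C).Nonempty) (hne : ¬ D ⊆ C) :
    (frontier C ∩ D).Nonempty := by
  by_contra hempty
  refine hne (hD.subset_left_of_subset_union hC isClosed_closure.isOpen_compl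
    (Set.disjoint_compl_right_iff_subset.2 subset_closure) (fun z hz => ?_) hmeet)
  by_contra h
  rw [Set.mem_union, not_or, Set.mem_compl_iff, not_not] at h
  exact hempty ⟨z, by rw [hC.frontier_eq]; exact ⟨h.2, h.1⟩, hz⟩

/-- Let `u` be `C¹` up to the boundary of `C`, and let `φ ∘ u` extend holomorphically to a domain
`D` bigger than `C`. Then `u` itself extends holomorphically across some boundary point in `D`:
where `φ' ≠ 0` by a local inverse of `φ`; and if `φ' ∘ u` vanishes on the boundary, then the
derivative of the extension has nonisolated zeros, so everything is constant. -/
theorem exists_local_extension {C D : Set ℂ} (hC : IsDomainC C) (hD : IsDomainC D) (hCD : C ⊆ D)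
    (hne : ¬ D ⊆ C) {u u₀ u₁ : ℂ → ℂ} (hu : DifferentiableOn ℂ u C)
    (hu₀ : ContinuousOn u₀ (closure C)) (hu₀u : ∀ z ∈ C, u₀ z = u z)
    (hu₁ : ContinuousOn u₁ (closure C)) (hu₁u : ∀ z ∈ C, u₁ z = deriv u z)
    (hacc : ∀ z ∈ frontier C ∩ D, AccPt z (𝓟 (frontier C)))
    {φ : ℂ → ℂ} (hφ : Differentiable ℂ φ) (hφc : ¬ ∃ c, ∀ z, φ z = c)
    {F : ℂ → ℂ} (hF : DifferentiableOn ℂ F D) (hFu : ∀ z ∈ C, F z = φ (u z)) :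
    ∃ z₀ ∈ frontier C, ∃ r > 0, ∃ v : ℂ → ℂ, DifferentiableOn ℂ v (ball z₀ r) ∧
      ball z₀ r ⊆ D ∧ ∀ z ∈ C ∩ ball z₀ r, v z = u z := by
  have hfc : frontier C ⊆ closure C := frontier_subset_closure
  have hFe : ∀ z ∈ closure C ∩ D, F z = φ (u₀ z) := by
    rintro z ⟨hz, hzD⟩
    have : (𝓝[C] z).NeBot := mem_closure_iff_nhdsWithin_neBot.1 hz
    refine tendsto_nhds_unique_of_eventuallyEq (l := 𝓝[C] z) (f := F) (g := φ ∘ u₀)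
      ((hF.continuousOn.continuousAt (hD.1.mem_nhds hzD)).tendsto.mono_left nhdsWithin_le_nhds)
      ((hφ.continuous.tendsto _).comp ((hu₀ z hz).mono_left (nhdsWithin_mono _ subset_closure))) ?_
    filter_upwards [self_mem_nhdsWithin] with w hw
    simp [hFu w hw, hu₀u w hw]
  by_cases hex : ∃ z₀ ∈ frontier C ∩ D, deriv φ (u₀ z₀) ≠ 0
  · obtain ⟨z₀, ⟨hz₀, hz₀D⟩, hd⟩ := hex
    obtain ⟨ψ, hψ, hψφ⟩ := exists_local_inverse hφ hd
    have hFc : ContinuousAt F z₀ := hF.continuousOn.continuousAt (hD.1.mem_nhds hz₀D)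
    have h1 : ∀ᶠ z in 𝓝 z₀, DifferentiableAt ℂ ψ (F z) :=
      hFc.eventually (by rwa [hFe z₀ ⟨hfc hz₀, hz₀D⟩])
    have h2 : ∀ᶠ z in 𝓝 z₀, z ∈ closure C → ψ (φ (u₀ z)) = u₀ z :=
      eventually_nhdsWithin_iff.1 ((hu₀ z₀ (hfc hz₀)).eventually hψφ)
    obtain ⟨r, hr, hball⟩ := Metric.eventually_nhds_iff_ball.1
      (h1.and (h2.and (hD.1.eventually_mem hz₀D)))
    refine ⟨z₀, hz₀, r, hr, ψ ∘ F, fun z hz => ?_, fun z hz => (hball z hz).2.2, ?_⟩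
    · exact ((hball z hz).1.comp z
        (hF.differentiableAt (hD.1.mem_nhds (hball z hz).2.2))).differentiableWithinAt
    · rintro z ⟨hzC, hz⟩
      have := (hball z hz).2.1 (subset_closure hzC)
      rw [hu₀u z hzC] at this
      rw [Function.comp, hFu z hzC, this]
  · push Not at hex
    obtain ⟨z₀, hz₀, hz₀D⟩ := frontier_inter_nonempty_of_not_subset hC.1
      hD.2.isPreconnected (hC.2.nonempty.mono fun z hz => ⟨hCD hz, hz⟩) hne
    have hF' : ContinuousOn (deriv F) D := (hF.deriv hD.1).continuousOn
    have hz : ∀ z ∈ frontier C ∩ D, deriv F z = 0 := by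
      rintro z ⟨hzC, hzD⟩
      have : (𝓝[C] z).NeBot := mem_closure_iff_nhdsWithin_neBot.1 (hfc hzC)
      have hmono : 𝓝[C] z ≤ 𝓝[closure C] z := nhdsWithin_mono _ subset_closure
      have hlim : Tendsto (fun w => deriv φ (u₀ w) * u₁ w) (𝓝[C] z)
          (𝓝 (deriv φ (u₀ z) * u₁ z)) :=
        ((hφ.deriv.continuous.tendsto _).comp ((hu₀ z (hfc hzC)).mono_left hmono)).mul
          ((hu₁ z (hfc hzC)).mono_left hmono)
      rw [hex z ⟨hzC, hzD⟩, zero_mul] at hlim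
      refine tendsto_nhds_unique_of_eventuallyEq (l := 𝓝[C] z)
        ((hF'.continuousAt (hD.1.mem_nhds hzD)).tendsto.mono_left nhdsWithin_le_nhds) hlim ?_
      filter_upwards [self_mem_nhdsWithin] with w hw
      have hev : F =ᶠ[𝓝 w] φ ∘ u := by
        filter_upwards [hC.1.mem_nhds hw] with x hx using hFu x hx
      rw [hev.deriv_eq, deriv_comp w (hφ _) (hu.differentiableAt (hC.1.mem_nhds hw)),
        hu₀u w hw, hu₁u w hw]
    have hzero : Set.EqOn (deriv F) 0 D := by
      refine ((hF.deriv hD.1).analyticOnNhd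
        hD.1).eqOn_zero_of_preconnected_of_frequently_eq_zero hD.2.isPreconnected hz₀D ?_
      have hfreq := (accPt_iff_frequently_nhdsNE.1 (hacc z₀ ⟨hz₀, hz₀D⟩)).and_eventually
        (eventually_nhdsWithin_of_eventually_nhds (hD.1.eventually_mem hz₀D))
      exact hfreq.mono hz
    obtain ⟨c, hc⟩ := hD.1.exists_is_const_of_deriv_eq_zero hD.2.isPreconnected hF hzero
    obtain ⟨r, hr, hball⟩ := Metric.isOpen_iff.1 hD.1 z₀ hz₀D
    have han := hu.analyticOnNhd hC.1
    rcases han.is_constant_or_isOpen hC.2.isPreconnected with ⟨w, hw⟩ | hopen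
    · exact ⟨z₀, hz₀, r, hr, fun _ => w, differentiableOn_const _, hball,
        fun z hz => (hw z hz.1).symm⟩
    · -- an open image would make `φ` constant on an open set
      exfalso
      obtain ⟨x, hx⟩ := hC.2.nonempty
      have hO := hopen C subset_rfl hC.1
      have hev : φ =ᶠ[𝓝 (u x)] fun _ => c := by
        filter_upwards [hO.mem_nhds ⟨x, hx, rfl⟩]
        rintro _ ⟨y, hy, rfl⟩
        rw [← hFu y hy, hc y (hCD hy)]
      have := (hφ.differentiableOn.analyticOnNhd isOpen_univ).eq_of_eventuallyEq
        (g := fun _ => c) (fun _ _ => analyticAt_const) hev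
      exact hφc ⟨c, fun z => congrFun this z⟩

/-! ### Boundary regularity -/

theorem zeroExt_apply {G : Set ℂ} (f : G → ℂ) {z : ℂ} (hz : z ∈ G) : zeroExt f z = f ⟨z, hz⟩ :=
  Subtype.val_injective.extend_apply f 0 ⟨z, hz⟩

theorem iteratedDeriv_congr_of_isOpen {G : Set ℂ} (hG : IsOpen G) {u v : ℂ → ℂ}
    (h : ∀ z ∈ G, u z = v z) (j : ℕ) : ∀ z ∈ G, iteratedDeriv j u z = iteratedDeriv j v z := by
  intro z hz
  refine Filter.EventuallyEq.iteratedDeriv_eq j ?_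
  filter_upwards [hG.mem_nhds hz] with w hw using h w hw

/-- The derivatives of `u` of order at most `m` extend continuously from `G` to its closure. -/
def ExtendsUpTo (G : Set ℂ) (m : ℕ) (u : ℂ → ℂ) : Prop :=
  ∀ j ≤ m, ∃ g : ℂ → ℂ, ContinuousOn g (closure G) ∧ ∀ z ∈ G, g z = iteratedDeriv j u z

namespace ExtendsUpTo

variable {G : Set ℂ} {m : ℕ} {u v : ℂ → ℂ}

theorem congr (hG : IsOpen G) (hu : ExtendsUpTo G m u) (h : ∀ z ∈ G, u z = v z) :
    ExtendsUpTo G m v := by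
  intro j hj
  obtain ⟨g, hg, hgu⟩ := hu j hj
  exact ⟨g, hg, fun z hz => (hgu z hz).trans (iteratedDeriv_congr_of_isOpen hG h j z hz)⟩

theorem mono {k : ℕ} (hu : ExtendsUpTo G m u) (hk : k ≤ m) : ExtendsUpTo G k u :=
  fun j hj => hu j (hj.trans hk)

theorem zero_iff : ExtendsUpTo G 0 u ↔
    ∃ g : ℂ → ℂ, ContinuousOn g (closure G) ∧ ∀ z ∈ G, g z = u z := by
  simp [ExtendsUpTo]

theorem succ_iff : ExtendsUpTo G (m + 1) u ↔
    ExtendsUpTo G 0 u ∧ ExtendsUpTo G m (deriv u) := by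
  constructor
  · intro h
    refine ⟨h.mono (Nat.zero_le _), fun j hj => ?_⟩
    simpa only [iteratedDeriv_succ'] using h (j + 1) (by omega)
  · rintro ⟨h0, h1⟩ (_ | j) hj
    · exact h0 0 le_rfl
    · simpa only [iteratedDeriv_succ'] using h1 j (by omega)

theorem add (hG : IsOpen G) (hu : DifferentiableOn ℂ u G) (hv : DifferentiableOn ℂ v G)
    (hue : ExtendsUpTo G m u) (hve : ExtendsUpTo G m v) :
    ExtendsUpTo G m fun z => u z + v z := by
  intro j hj
  obtain ⟨g, hg, hgu⟩ := hue j hj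
  obtain ⟨h, hh, hhv⟩ := hve j hj
  refine ⟨fun z => g z + h z, hg.add hh, fun z hz => ?_⟩
  simp only [hgu z hz, hhv z hz]
  exact (iteratedDeriv_fun_add (hu.analyticAt (hG.mem_nhds hz)).contDiffAt
    (hv.analyticAt (hG.mem_nhds hz)).contDiffAt).symm

theorem mul (hG : IsOpen G) (hu : DifferentiableOn ℂ u G) (hv : DifferentiableOn ℂ v G)
    (hue : ExtendsUpTo G m u) (hve : ExtendsUpTo G m v) :
    ExtendsUpTo G m fun z => u z * v z := by
  have base : ∀ {k : ℕ} {u v : ℂ → ℂ}, ExtendsUpTo G k u → ExtendsUpTo G k v →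
      ExtendsUpTo G 0 fun z => u z * v z := by
    intro k u v hue hve
    rw [zero_iff]
    obtain ⟨g, hg, hgu⟩ := zero_iff.1 (hue.mono (Nat.zero_le _))
    obtain ⟨h, hh, hhv⟩ := zero_iff.1 (hve.mono (Nat.zero_le _))
    exact ⟨fun z => g z * h z, hg.mul hh, fun z hz => by simp only [hgu z hz, hhv z hz]⟩
  induction m generalizing u v with
  | zero => exact base hue hve
  | succ m ih =>
    rw [succ_iff]
    refine ⟨base hue hve, ?_⟩
    have h1 := ih (hu.deriv hG) hv (succ_iff.1 hue).2 (hve.mono m.le_succ)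
    have h2 := ih hu (hv.deriv hG) (hue.mono m.le_succ) (succ_iff.1 hve).2
    refine (h1.add hG ((hu.deriv hG).mul hv) (hu.mul (hv.deriv hG)) h2).congr hG fun z hz => ?_
    exact (deriv_fun_mul (hu.differentiableAt (hG.mem_nhds hz))
      (hv.differentiableAt (hG.mem_nhds hz))).symm

theorem comp_entire (hG : IsOpen G) (hu : DifferentiableOn ℂ u G) (hue : ExtendsUpTo G m u)
    {φ : ℂ → ℂ} (hφ : Differentiable ℂ φ) : ExtendsUpTo G m fun z => φ (u z) := by
  induction m generalizing φ with
  | zero =>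
    rw [zero_iff] at hue ⊢
    obtain ⟨g, hg, hgu⟩ := hue
    exact ⟨fun z => φ (g z), hφ.continuous.comp_continuousOn hg,
      fun z hz => by simp only [hgu z hz]⟩
  | succ m ih =>
    have hum := hue.mono m.le_succ
    rw [succ_iff]
    refine ⟨(ih hum hφ).mono m.zero_le, ?_⟩
    refine ((ih hum hφ.deriv).mul hG (hφ.deriv.comp_differentiableOn hu) (hu.deriv hG)
      (succ_iff.1 hue).2).congr hG fun z hz => ?_
    exact (deriv_comp z (hφ _) (hu.differentiableAt (hG.mem_nhds hz))).symm

end ExtendsUpTo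

theorem comp_mem_holo {G : Set ℂ} {f : G → ℂ} (hf : f ∈ holo G) {φ : ℂ → ℂ}
    (hφ : Differentiable ℂ φ) : φ ∘ f ∈ holo G := by
  refine (hφ.comp_differentiableOn hf).congr fun z hz => ?_
  simp [zeroExt_apply _ hz]

theorem comp_mem_boundaryRegular_top {G : Set ℂ} (hG : IsOpen G) {f : G → ℂ}
    (hf : f ∈ boundaryRegular ⊤ G) {φ : ℂ → ℂ} (hφ : Differentiable ℂ φ) :
    φ ∘ f ∈ boundaryRegular ⊤ G := by
  refine ⟨comp_mem_holo hf.1 hφ, fun j _ => ?_⟩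
  have h : ExtendsUpTo G j (zeroExt f) := fun i _ => hf.2 i le_top
  refine ((h.comp_entire hG hf.1 hφ).congr hG fun z hz => ?_) j le_rfl
  simp [zeroExt_apply _ hz]

/-! ### Smooth functions that cannot be continued across any boundary point -/

/-- The weight `2⁻ⁿ exp (-1/d)`, `d = dist (wₙ, G)`: multiplied by it, each power of `(z - wₙ)⁻¹` is
bounded on `G` by a summable sequence in `n`. -/
noncomputable def poleWeight (G : Set ℂ) (w : ℕ → ℂ) (n : ℕ) : ℝ :=
  (1 / 2) ^ n * Real.exp (-(infDist (w n) G)⁻¹)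

theorem poleWeight_pos (G : Set ℂ) (w : ℕ → ℂ) (n : ℕ) : 0 < poleWeight G w n := by
  unfold poleWeight
  positivity

/-- The series `∑ aₙ cₙ (z - wₙ)^(-k-1)` with coefficients `aₙ ∈ [0, 1]` and weights `cₙ`. -/
noncomputable def poleSeries (G : Set ℂ) (w : ℕ → ℂ) (k : ℕ) (a : ℕ → unitInterval) (z : ℂ) : ℂ :=
  ∑' n, ((a n : ℝ) : ℂ) * poleWeight G w n * (z - w n)⁻¹ ^ (k + 1)

section PoleSeries

variable {G : Set ℂ} {w : ℕ → ℂ}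

theorem norm_poleSeries_term_le (hw : ∀ n, w n ∉ closure G) (hG : G.Nonempty) (k n : ℕ)
    (a : unitInterval) {z : ℂ} (hz : z ∈ closure G) :
    ‖((a : ℝ) : ℂ) * poleWeight G w n * (z - w n)⁻¹ ^ (k + 1)‖ ≤
      (k + 1).factorial * (1 / 2) ^ n := by
  have hd : 0 < infDist (w n) G := by
    rw [← infDist_closure]
    exact (isClosed_closure.notMem_iff_infDist_pos hG.closure).1 (hw n)
  have hdz : infDist (w n) G ≤ ‖z - w n‖ := by
    rw [← infDist_closure, ← dist_eq_norm, dist_comm]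
    exact infDist_le_dist_of_mem hz
  have hexp := Real.pow_div_factorial_le_exp _ (inv_nonneg.2 hd.le) (k + 1)
  rw [div_le_iff₀ (by positivity)] at hexp
  have ha : ‖((a : ℝ) : ℂ)‖ ≤ 1 := by
    rw [Complex.norm_real, Real.norm_of_nonneg a.2.1]
    exact a.2.2
  have hp : ‖(poleWeight G w n : ℂ)‖ = poleWeight G w n := by
    rw [Complex.norm_real, Real.norm_of_nonneg (poleWeight_pos G w n).le]
  rw [norm_mul, norm_mul, norm_pow, norm_inv, hp]
  calc ‖((a : ℝ) : ℂ)‖ * poleWeight G w n * ‖z - w n‖⁻¹ ^ (k + 1)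
      ≤ 1 * poleWeight G w n * (infDist (w n) G)⁻¹ ^ (k + 1) := by
        have := (poleWeight_pos G w n).le
        gcongr
    _ ≤ 1 * poleWeight G w n * (Real.exp (infDist (w n) G)⁻¹ * (k + 1).factorial) := by
        have := (poleWeight_pos G w n).le
        gcongr
    _ = (k + 1).factorial * (1 / 2) ^ n := by
        rw [poleWeight, Real.exp_neg]
        field_simp

theorem summable_poleBound (k : ℕ) :
    Summable fun n : ℕ => ((k + 1).factorial : ℝ) * (1 / 2) ^ n :=
  summable_geometric_two.mul_left _

theorem summable_poleSeries (hw : ∀ n, w n ∉ closure G) (hG : G.Nonempty) (k : ℕ)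
    (a : ℕ → unitInterval) {z : ℂ} (hz : z ∈ closure G) :
    Summable fun n => ((a n : ℝ) : ℂ) * poleWeight G w n * (z - w n)⁻¹ ^ (k + 1) :=
  (summable_poleBound k).of_norm_bounded fun n => norm_poleSeries_term_le hw hG k n (a n) hz

theorem continuousOn_poleSeries (hw : ∀ n, w n ∉ closure G) (hG : G.Nonempty) (k : ℕ)
    (a : ℕ → unitInterval) : ContinuousOn (poleSeries G w k a) (closure G) := by
  refine continuousOn_tsum (fun n => ?_) (summable_poleBound k)
    fun n z hz => norm_poleSeries_term_le hw hG k n (a n) hz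
  refine continuousOn_const.mul (ContinuousOn.pow (ContinuousOn.inv₀ (by fun_prop) ?_) _)
  intro z hz h
  exact hw n (sub_eq_zero.1 h ▸ hz)

theorem continuous_poleSeries_coeff (hw : ∀ n, w n ∉ closure G) (hG : G.Nonempty) (k : ℕ)
    {z : ℂ} (hz : z ∈ closure G) : Continuous fun a => poleSeries G w k a z := by
  refine continuous_tsum (fun n => ?_) (summable_poleBound k)
    fun n a => norm_poleSeries_term_le hw hG k n (a n) hz
  fun_prop

theorem hasDerivAt_poleSeries (hw : ∀ n, w n ∉ closure G) (hG : IsDomainC G) (k : ℕ)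
    (a : ℕ → unitInterval) {z : ℂ} (hz : z ∈ G) :
    HasDerivAt (poleSeries G w k a) (-(k + 1) * poleSeries G w (k + 1) a z) z := by
  have hne := hG.2.nonempty
  have := hasDerivAt_tsum_of_isPreconnected
    (g := fun n z => ((a n : ℝ) : ℂ) * poleWeight G w n * (z - w n)⁻¹ ^ (k + 1))
    (g' := fun n z => -(k + 1) *
      (((a n : ℝ) : ℂ) * poleWeight G w n * (z - w n)⁻¹ ^ (k + 1 + 1)))
    ((summable_poleBound (k + 1)).mul_left ((k : ℝ) + 1)) hG.1 hG.2.isPreconnected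
    (fun n y hy => ?_) (fun n y hy => ?_) hz
    (summable_poleSeries hw hne k a (subset_closure hz)) hz
  · rw [tsum_mul_left] at this
    exact this
  · have hyn : y - w n ≠ 0 := fun h => hw n (sub_eq_zero.1 h ▸ subset_closure hy)
    have h1 := ((((hasDerivAt_id y).sub_const (w n)).inv hyn).pow (k + 1)).const_mul
      (((a n : ℝ) : ℂ) * poleWeight G w n)
    convert! h1 using 1
    simp only [id, Nat.add_sub_cancel, Pi.inv_apply]
    rw [div_eq_mul_inv, ← inv_pow]
    push_cast
    ring
  · rw [norm_mul]
    refine mul_le_mul (le_of_eq ?_)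
      (norm_poleSeries_term_le hw hne (k + 1) n (a n) (subset_closure hy)) (norm_nonneg _)
      (by positivity)
    rw [norm_neg]
    exact_mod_cast Complex.norm_natCast (k + 1)

theorem iteratedDeriv_poleSeries (hw : ∀ n, w n ∉ closure G) (hG : IsDomainC G) (j : ℕ)
    (a : ℕ → unitInterval) : ∀ z ∈ G, iteratedDeriv j (poleSeries G w 0 a) z =
      (-1) ^ j * j.factorial * poleSeries G w j a z := by
  induction j with
  | zero => simp
  | succ j ih =>
    intro z hz
    rw [iteratedDeriv_succ]
    have hev : iteratedDeriv j (poleSeries G w 0 a) =ᶠ[𝓝 z]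
        fun z => (-1) ^ j * j.factorial * poleSeries G w j a z := by
      filter_upwards [hG.1.mem_nhds hz] with x hx using ih x hx
    rw [hev.deriv_eq, ((hasDerivAt_poleSeries hw hG j a hz).const_mul _).deriv,
      Nat.factorial_succ]
    push_cast
    ring

/-- Changing the single coefficient `aₘ` changes the series by a multiple of its `m`-th term. -/
theorem poleSeries_update_sub (hw : ∀ n, w n ∉ closure G) (hG : G.Nonempty) (k : ℕ)
    (a : ℕ → unitInterval) (m : ℕ) (s t : unitInterval) {z : ℂ} (hz : z ∈ closure G) :
    poleSeries G w k (Function.update a m s) z - poleSeries G w k (Function.update a m t) z =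
      (((s : ℝ) : ℂ) - (t : ℝ)) * poleWeight G w m * (z - w m)⁻¹ ^ (k + 1) := by
  rw [poleSeries, poleSeries, ← (summable_poleSeries hw hG k _ hz).tsum_sub
    (summable_poleSeries hw hG k _ hz), tsum_eq_single m]
  · simp only [Function.update_self]
    ring
  · intro n hn
    simp [Function.update_of_ne hn]

/-- The coefficient sequences whose Taylor coefficients at `p` exceed the Cauchy bound `M R⁻ʲ` for
some `j` are dense as soon as some pole lies within `R` of `p`: along the coefficient of
that pole at most one value can fail. -/
theorem dense_exists_lt_poleSeries (hw : ∀ n, w n ∉ closure G) (hG : G.Nonempty) {p : ℂ}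
    (hp : p ∈ closure G) {R : ℝ} (M : ℝ) {m : ℕ} (hm : w m ∈ ball p R) :
    Dense {a | ∃ j, M < ‖poleSeries G w j a p‖ * R ^ j} := by
  set U : Set (ℕ → unitInterval) := {a | ∃ j, M < ‖poleSeries G w j a p‖ * R ^ j} with hU
  have hpw : 0 < ‖p - w m‖ := by
    rw [norm_pos_iff, sub_ne_zero]
    rintro rfl
    exact hw m hp
  have hR : ‖p - w m‖ < R := by
    rw [← dist_eq_norm, dist_comm]
    exact hm
  have hR0 : 0 < R := hpw.trans hR
  have hone : ∀ (a : ℕ → unitInterval) (s t : unitInterval), Function.update a m s ∉ U →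
      Function.update a m t ∉ U → s = t := by
    intro a s t hs ht
    by_contra hst
    simp only [hU, Set.mem_ofPred_eq, not_exists, not_lt] at hs ht
    have hst' : 0 < |(s : ℝ) - t| := abs_pos.2 (sub_ne_zero.2 fun h => hst (Subtype.ext h))
    have hc : 0 < |(s : ℝ) - t| * poleWeight G w m * ‖p - w m‖⁻¹ :=
      mul_pos (mul_pos hst' (poleWeight_pos G w m)) (inv_pos.2 hpw)
    have hgt : 1 < R / ‖p - w m‖ := (one_lt_div hpw).2 hR
    -- the two series differ by a multiple of `(z - wₘ)⁻¹`, whose Taylor coefficients at `p` grow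
    -- faster than `R⁻ʲ`
    obtain ⟨j, hj⟩ := pow_unbounded_of_one_lt
      (2 * M / (|(s : ℝ) - t| * poleWeight G w m * ‖p - w m‖⁻¹)) hgt
    rw [div_lt_iff₀ hc] at hj
    have hdiff := poleSeries_update_sub hw hG j a m s t hp
    have hn : ‖poleSeries G w j (Function.update a m s) p -
        poleSeries G w j (Function.update a m t) p‖ * R ^ j =
        (R / ‖p - w m‖) ^ j * (|(s : ℝ) - t| * poleWeight G w m * ‖p - w m‖⁻¹) := by
      rw [hdiff, norm_mul, norm_mul, norm_pow, norm_inv, ← Complex.ofReal_sub, Complex.norm_real,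
        Complex.norm_real, Real.norm_of_nonneg (poleWeight_pos G w m).le, Real.norm_eq_abs, div_pow,
        pow_succ, inv_pow]
      field_simp
    have htri := mul_le_mul_of_nonneg_right (norm_sub_le
      (poleSeries G w j (Function.update a m s) p)
      (poleSeries G w j (Function.update a m t) p)) (pow_nonneg hR0.le j)
    rw [hn, add_mul] at htri
    linarith [hs j, ht j]
  intro a
  rw [_root_.mem_closure_iff]
  intro O hO haO
  let ι : unitInterval → ℕ → unitInterval := Function.update a m
  have hι : Continuous ι := continuous_const.update m continuous_id
  have hmem : a m ∈ ι ⁻¹' O := by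
    simpa [ι] using haO
  -- otherwise the open set of admissible values of the `m`-th coefficient is a single point
  by_contra hempty
  have hsub : ∀ s ∈ ι ⁻¹' O, s = a m := fun s hs => by
    refine hone a s (a m) (fun h => hempty ⟨_, hs, h⟩) fun h => hempty ⟨_, hmem, h⟩
  have hsing : ι ⁻¹' O = {a m} := Set.Subset.antisymm hsub (Set.singleton_subset_iff.2 hmem)
  exact not_isOpen_singleton (a m) (hsing ▸ hO.preimage hι)

theorem isOpen_exists_lt_poleSeries (hw : ∀ n, w n ∉ closure G) (hG : G.Nonempty) {p : ℂ}
    (hp : p ∈ closure G) (R M : ℝ) :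
    IsOpen {a | ∃ j, M < ‖poleSeries G w j a p‖ * R ^ j} := by
  have : {a | ∃ j, M < ‖poleSeries G w j a p‖ * R ^ j} =
      ⋃ j, {a | M < ‖poleSeries G w j a p‖ * R ^ j} := by
    ext a
    simp
  rw [this]
  exact isOpen_iUnion fun j => isOpen_lt continuous_const
    ((continuous_poleSeries_coeff hw hG j hp).norm.mul_const _)

end PoleSeries

/-- On a regular domain there is a function, smooth up to the boundary, whose Taylor series at a
dense set of points `p` has no larger radius of convergence than the distance from `p` to the
exterior: by Baire, almost every series of poles dense in the exterior has this property. -/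
theorem exists_boundaryRegular_taylor_unbounded {G : Set ℂ} (hG : IsRegularDomain G)
    (hne : G ≠ Set.univ) :
    ∃ (u : ℂ → ℂ) (S : Set ℂ), DifferentiableOn ℂ u G ∧ (∀ m, ExtendsUpTo G m u) ∧
      S ⊆ G ∧ G ⊆ closure S ∧
      ∀ p ∈ S, ∀ R : ℚ, ¬ ball p R ⊆ closure G → ∀ M : ℝ,
        ∃ j : ℕ, M < ‖iteratedDeriv j u p‖ / j.factorial * (R : ℝ) ^ j := by
  have hGne := hG.1.2.nonempty
  have hext : (closure G)ᶜ.Nonempty := by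
    rw [Set.nonempty_compl]
    intro h
    exact hne (by rw [hG.2, h, interior_univ])
  have : Nonempty ((closure G)ᶜ : Set ℂ) := hext.to_subtype
  obtain ⟨w', hw'⟩ := TopologicalSpace.exists_dense_seq ((closure G)ᶜ : Set ℂ)
  let w : ℕ → ℂ := fun n => w' n
  have hw : ∀ n, w n ∉ closure G := fun n => (w' n).2
  have hball : ∀ (p : ℂ) (R : ℝ), ¬ ball p R ⊆ closure G → ∃ m, w m ∈ ball p R := by
    intro p R h
    obtain ⟨x, hx, hxG⟩ := Set.not_subset.1 h
    obtain ⟨m, hm⟩ := hw'.exists_mem_open (isOpen_ball.preimage continuous_subtype_val)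
      ⟨(⟨x, hxG⟩ : ((closure G)ᶜ : Set ℂ)), hx⟩
    exact ⟨m, hm⟩
  obtain ⟨S, hSG, hSc, hS⟩ :=
    (TopologicalSpace.IsSeparable.of_separableSpace G).exists_countable_dense_subset
  have : Countable S := hSc.to_subtype
  let I := {x : S × ℚ × ℕ // ¬ ball (x.1 : ℂ) x.2.1 ⊆ closure G}
  have hdense : Dense (⋂ x : I, {a | ∃ j,
      (x.1.2.2 : ℝ) < ‖poleSeries G w j a x.1.1‖ * (x.1.2.1 : ℝ) ^ j}) := by
    refine dense_iInter_of_isOpen (fun x => ?_) fun x => ?_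
    · exact isOpen_exists_lt_poleSeries hw hGne (subset_closure (hSG x.1.1.2)) _ _
    · obtain ⟨m, hm⟩ := hball _ _ x.2
      exact dense_exists_lt_poleSeries hw hGne (subset_closure (hSG x.1.1.2)) _ hm
  obtain ⟨a, ha⟩ := hdense.nonempty
  rw [Set.mem_iInter] at ha
  refine ⟨poleSeries G w 0 a, S, fun z hz =>
    (hasDerivAt_poleSeries hw hG.1 0 a hz).differentiableAt.differentiableWithinAt, ?_, hSG, hS,
    ?_⟩
  · intro m j _
    exact ⟨fun z => (-1) ^ j * j.factorial * poleSeries G w j a z,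
      continuousOn_const.mul (continuousOn_poleSeries hw hGne j a),
      fun z hz => (iteratedDeriv_poleSeries hw hG.1 j a z hz).symm⟩
  · intro p hp R hR M
    obtain ⟨N, hN⟩ := exists_nat_gt M
    obtain ⟨j, hj⟩ := ha ⟨(⟨p, hp⟩, R, N), hR⟩
    refine ⟨j, hN.trans (hj.trans_eq ?_)⟩
    rw [iteratedDeriv_poleSeries hw hG.1 j a p (hSG hp)]
    simp only [norm_mul, norm_pow, norm_neg, norm_one, one_pow, one_mul, Complex.norm_natCast]
    field_simp

/-! ### Jordan domains are regular -/

theorem eq_of_exp_eq_exp {X : Type*} [TopologicalSpace X] [PreconnectedSpace X] {g : X → ℂ}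
    (hg : Continuous g) (h : ∀ x y, Complex.exp (g x) = Complex.exp (g y)) (x y : X) :
    g x = g y :=
  Complex.isCoveringMap_exp.isSeparatedMap.const_of_comp
    Complex.isCoveringMap_exp.isLocalHomeomorph.isLocallyInjective hg
    (fun a b => Subtype.ext (h a b)) x y

theorem not_exists_continuousOn_log_punctured_ball (p : ℂ) {ε : ℝ} (hε : 0 < ε) :
    ¬ ∃ L : ℂ → ℂ, ContinuousOn L (ball p ε \ {p}) ∧
      ∀ z ∈ ball p ε \ {p}, Complex.exp (L z) = z - p := by
  rintro ⟨L, hL, hexp⟩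
  let ρ : ℝ := ε / 2
  have hρ : 0 < ρ := half_pos hε
  let circ : ℝ → ℂ := fun t => p + ρ * Complex.exp (t * Complex.I)
  have hmem : ∀ t, circ t ∈ ball p ε \ {p} := by
    intro t
    have hn : ‖circ t - p‖ = ρ := by
      simp [circ, Complex.norm_exp_ofReal_mul_I, abs_of_pos hρ]
    refine ⟨?_, fun h => ?_⟩
    · rw [mem_ball_iff_norm, hn]
      exact half_lt_self hε
    · rw [Set.mem_singleton_iff] at h
      rw [h, sub_self, norm_zero] at hn
      exact hρ.ne hn
  have hcont : Continuous fun t : ℝ => L (circ t) - t * Complex.I :=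
    (hL.comp_continuous (by fun_prop) hmem).sub (by fun_prop)
  have hval : ∀ t : ℝ, Complex.exp (L (circ t) - t * Complex.I) = ρ := by
    intro t
    rw [Complex.exp_sub, hexp _ (hmem t)]
    simp [circ, Complex.exp_ne_zero]
  have heq := eq_of_exp_eq_exp hcont (fun x y => by rw [hval, hval]) 0 (2 * Real.pi)
  have hcirc : circ (2 * Real.pi) = circ 0 := by
    simp [circ, Complex.exp_two_pi_mul_I]
  rw [hcirc] at heq
  have : (2 * Real.pi * Complex.I : ℂ) = 0 := by
    push_cast at heq
    linear_combination heq
  exact Complex.two_pi_I_ne_zero this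

/-- The coordinate `1 / (c - w)` on the Riemann sphere, with the value `0` at infinity (the value
at `c` is irrelevant). -/
noncomputable def sphereInv (c : ℂ) (w : OnePoint ℂ) : ℂ :=
  w.elim 0 fun w => (c - w)⁻¹

theorem continuousAt_sphereInv {c : ℂ} {w : OnePoint ℂ} (hw : w ≠ c) :
    ContinuousAt (sphereInv c) w := by
  induction w using OnePoint.rec with
  | infty =>
    rw [OnePoint.continuousAt_infty', Filter.coclosedCompact_eq_cocompact,
      ← Metric.cobounded_eq_cocompact]
    exact tendsto_inv₀_cobounded.comp (tendsto_const_sub_cobounded c)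
  | coe w =>
    rw [OnePoint.continuousAt_coe]
    have : c - w ≠ 0 := sub_ne_zero.2 fun h => hw (by rw [h])
    exact (continuousAt_const.sub continuousAt_id).inv₀ this

/-- The function `(z - w) / (c - w)`, continued by `1` to `w = ∞`, written in a form that is
visibly jointly continuous. -/
noncomputable def crossFactor (c z : ℂ) (w : OnePoint ℂ) : ℂ := 1 + (z - c) * sphereInv c w

theorem crossFactor_coe {c z w : ℂ} (hw : w ≠ c) : crossFactor c z w = (z - w) / (c - w) := by
  have : c - w ≠ 0 := sub_ne_zero.2 hw.symm
  simp only [crossFactor, sphereInv, OnePoint.elim_some]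
  field_simp
  ring

theorem crossFactor_ne_zero {c z : ℂ} {w : OnePoint ℂ} (hwc : w ≠ c) (hwz : w ≠ z) :
    crossFactor c z w ≠ 0 := by
  induction w using OnePoint.rec with
  | infty => simp [crossFactor, sphereInv]
  | coe w =>
    have h1 : w ≠ c := fun h => hwc (by rw [h])
    have h2 : w ≠ z := fun h => hwz (by rw [h])
    rw [crossFactor_coe h1]
    exact div_ne_zero (sub_ne_zero.2 h2.symm) (sub_ne_zero.2 h1.symm)

/-- Off a path in the sphere, the quotient of the factors vanishing at the two end points of the
path has a continuous logarithm: lift the homotopy that moves one end point along the path to the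
other. -/
theorem exists_log_off_path (γ : C(unitInterval, OnePoint ℂ)) {c : ℂ} (hc : ∀ t, γ t ≠ c) :
    ∃ L : ℂ → ℂ, ContinuousOn L {z | ∀ t, γ t ≠ z} ∧ ∀ z : ℂ, (∀ t, γ t ≠ z) →
      Complex.exp (L z) = crossFactor c z (γ 1) / crossFactor c z (γ 0) := by
  classical
  let A : Set ℂ := {z | ∀ t, γ t ≠ z}
  have hs : Continuous fun t => sphereInv c (γ t) :=
    continuous_iff_continuousAt.2 fun t =>
      (continuousAt_sphereInv (hc t)).comp γ.continuous.continuousAt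
  have hne : ∀ (z : A) (t), crossFactor c z (γ t) ≠ 0 := fun z t =>
    crossFactor_ne_zero (hc t) (z.2 t)
  let H : C(unitInterval × A, {z : ℂ // z ≠ 0}) :=
    { toFun := fun x => ⟨crossFactor c x.2 (γ x.1) / crossFactor c x.2 (γ 0),
        div_ne_zero (hne _ _) (hne _ _)⟩
      continuous_toFun := by
        refine Continuous.subtype_mk (Continuous.div ?_ ?_ fun x => hne _ _) _
        · have := hs.comp (continuous_fst (X := unitInterval) (Y := A))
          unfold crossFactor
          simp only [Function.comp_def] at this
          fun_prop
        · unfold crossFactor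
          fun_prop }
  have H0 : ∀ a : A, H (0, a) = ⟨Complex.exp ((ContinuousMap.const A (0 : ℂ)) a),
      Complex.exp_ne_zero _⟩ := by
    intro a
    apply Subtype.ext
    simp [H, div_self (hne a 0)]
  let Λ := Complex.isCoveringMap_exp.liftHomotopy H (ContinuousMap.const A 0) H0
  have hΛ := Complex.isCoveringMap_exp.liftHomotopy_lifts H (ContinuousMap.const A 0) H0
  refine ⟨fun z => if h : z ∈ A then Λ (1, ⟨z, h⟩) else 0, ?_, ?_⟩
  · rw [continuousOn_iff_continuous_domRestrict]
    have : Continuous fun a : A => Λ (1, a) := Λ.continuous.comp (by fun_prop)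
    refine this.congr fun a => ?_
    have ha : (a : ℂ) ∈ A := a.2
    simp only [Set.domRestrict_apply, dif_pos ha]
  · intro z hz
    have hz' : z ∈ A := hz
    simp only [dif_pos hz']
    exact congrArg Subtype.val (congrFun hΛ (1, ⟨z, hz'⟩))

theorem isOpen_off_path (γ : C(unitInterval, OnePoint ℂ)) : IsOpen {z : ℂ | ∀ t, γ t ≠ z} := by
  have h : IsClosed (Set.range γ) := (isCompact_range γ.continuous).isClosed
  have : {z : ℂ | ∀ t, γ t ≠ z} = (fun z : ℂ => (z : OnePoint ℂ)) ⁻¹' (Set.range γ)ᶜ := by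
    ext z
    simp
  rw [this]
  exact h.isOpen_compl.preimage OnePoint.continuous_coe

/-- Suppose a finite point `p` of the Jordan curve `∂G` had a neighbourhood inside the closure of
`G`. The two arcs of the curve from an antipodal point `q` to `p` give logarithms of the factor
vanishing at `p` off each arc. They differ by a constant on `G`, hence glue to a logarithm
of `z - p` on a punctured neighbourhood of `p`, which does not exist. -/
theorem IsJordanDomain.isRegularDomain {G : Set ℂ} (h : IsJordanDomain G) :
    IsRegularDomain G := by
  classical
  obtain ⟨hG, ⟨e⟩⟩ := h
  refine ⟨hG, Set.Subset.antisymm hG.1.subset_interior_closure fun p hp => ?_⟩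
  by_contra hpG
  let E : Circle → OnePoint ℂ := fun θ => (e θ).1
  have hEc : Continuous E := continuous_subtype_val.comp e.continuous
  have hEi : Function.Injective E := Subtype.val_injective.comp e.injective
  have hEG : ∀ z ∈ G, ∀ θ, E θ ≠ z := by
    intro z hz θ hθ
    have h1 : E θ ∈ frontier ((fun z : ℂ => (z : OnePoint ℂ)) '' G) := (e θ).2
    rw [(OnePoint.isOpenMap_coe _ hG.1).frontier_eq] at h1
    exact h1.2 ⟨z, hz, hθ.symm⟩
  have hEsurj : ∀ z ∈ closure G, z ∉ G → ∃ θ, E θ = z := by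
    intro z hz hzG
    have hmem : (z : OnePoint ℂ) ∈ frontier ((fun z : ℂ => (z : OnePoint ℂ)) '' G) := by
      rw [(OnePoint.isOpenMap_coe _ hG.1).frontier_eq]
      refine ⟨image_closure_subset_closure_image OnePoint.continuous_coe ⟨z, hz, rfl⟩, ?_⟩
      rintro ⟨w, hw, hwz⟩
      exact hzG (OnePoint.coe_injective hwz ▸ hw)
    obtain ⟨θ, hθ⟩ := e.surjective ⟨_, hmem⟩
    exact ⟨θ, congrArg Subtype.val hθ⟩
  obtain ⟨c, hc⟩ := hG.2.nonempty
  have hpcl : p ∈ closure G := interior_subset hp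
  obtain ⟨ω, hω⟩ := hEsurj p hpcl hpG
  have hpc : p ≠ c := fun h => hpG (h ▸ hc)
  let q : OnePoint ℂ := E (ω * Circle.exp Real.pi)
  have hexpπ : (Circle.exp Real.pi)⁻¹ = Circle.exp Real.pi := by
    apply Circle.ext
    rw [Circle.coe_inv, Circle.coe_exp, Complex.exp_pi_mul_I]
    norm_num
  have hqp : q ≠ p := by
    intro h
    rw [← hω] at h
    have h1 : Circle.exp Real.pi = 1 := by simpa using hEi h
    have h2 := congrArg (fun x : Circle => (x : ℂ)) h1
    simp [Circle.coe_exp, Complex.exp_pi_mul_I] at h2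
    norm_num at h2
  have hqc : q ≠ c := hEG c hc _
  -- the paths `γ 1` and `γ (-1)` run from `q` to `p` along the two halves of the curve
  let γ : ℝ → C(unitInterval, OnePoint ℂ) := fun σ =>
    ⟨fun t => E (ω * Circle.exp (σ * (Real.pi * (1 - t)))), by fun_prop⟩
  have hγ1 : ∀ σ, γ σ 1 = p := by
    intro σ
    simp [γ, hω]
  have hγ0 : γ 1 0 = q ∧ γ (-1) 0 = q := by
    simp [γ, q, hexpπ]
  have hγG : ∀ σ, ∀ z ∈ G, ∀ t, γ σ t ≠ z := fun σ z hz t => hEG z hz _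
  have hcover : ∀ z ∈ closure G, (∀ t, γ 1 t ≠ z) → (∀ t, γ (-1) t ≠ z) → z ∈ G := by
    intro z hz h1 h2
    by_contra hzG
    obtain ⟨θ, hθ⟩ := hEsurj z hz hzG
    let s : ℝ := Complex.arg (ω⁻¹ * θ : Circle)
    have hs : ω * Circle.exp s = θ := by
      rw [Circle.exp_arg, mul_inv_cancel_left]
    have hsl : -Real.pi < s := Complex.neg_pi_lt_arg _
    have hsu : s ≤ Real.pi := Complex.arg_le_pi _
    have hπ := Real.pi_pos
    have hpar : ∀ x : ℝ, 0 ≤ x → x ≤ Real.pi → ∃ t : unitInterval, Real.pi * (1 - t) = x := by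
      intro x hx0 hx1
      refine ⟨⟨1 - x / Real.pi, ?_, ?_⟩, ?_⟩
      · rw [sub_nonneg, div_le_one hπ]
        exact hx1
      · rw [sub_le_self_iff]
        positivity
      · simp only
        field_simp
        ring
    rcases le_total 0 s with h0 | h0
    · obtain ⟨t, ht⟩ := hpar s h0 hsu
      exact h1 t (by simp only [γ, ContinuousMap.coe_mk, ht, one_mul, hs, hθ])
    · obtain ⟨t, ht⟩ := hpar (-s) (by linarith) (by linarith)
      exact h2 t (by simp only [γ, ContinuousMap.coe_mk, ht, neg_mul, one_mul, neg_neg, hs, hθ])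
  have hmeet : ∀ z : ℂ, z ≠ p → q ≠ z → (∃ t, γ 1 t = z) → ∀ t, γ (-1) t ≠ z := by
    rintro z hzp hqz ⟨t, ht⟩ t' ht'
    have hπ := Real.pi_pos
    have hE : Circle.exp (Real.pi * (1 - t)) = Circle.exp (-(Real.pi * (1 - t'))) := by
      have := hEi (ht.trans ht'.symm)
      simpa using this
    have hx0 : 0 ≤ Real.pi * (1 - t) := mul_nonneg hπ.le (by linarith [t.2.2])
    have hx1 : Real.pi * (1 - t) ≤ Real.pi := by nlinarith [t.2.1]
    have hy0 : 0 ≤ Real.pi * (1 - t') := mul_nonneg hπ.le (by linarith [t'.2.2])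
    have hy1 : Real.pi * (1 - t') ≤ Real.pi := by nlinarith [t'.2.1]
    rcases hy1.lt_or_eq with hlt | heq
    · have := congrArg (fun x : Circle => Complex.arg x) hE
      rw [Circle.arg_exp (by linarith) hx1, Circle.arg_exp (by linarith) (by linarith)] at this
      have h0 : Real.pi * (1 - t) = 0 := by linarith
      apply hzp
      apply OnePoint.coe_injective
      rw [← ht, ← hω]
      simp [γ, h0]
    · apply hqz
      rw [← ht']
      simp [γ, q, heq, hexpπ]
  obtain ⟨L₁, hL₁, hL₁e⟩ := exists_log_off_path (γ 1) (hγG 1 c hc)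
  obtain ⟨L₂, hL₂, hL₂e⟩ := exists_log_off_path (γ (-1)) (hγG (-1) c hc)
  rw [hγ1, hγ0.1] at hL₁e
  rw [hγ1, hγ0.2] at hL₂e
  have hconst : ∃ k, ∀ z ∈ G, L₁ z = L₂ z + k := by
    have : PreconnectedSpace G := Subtype.preconnectedSpace hG.2.isPreconnected
    have hcont : Continuous fun z : G => L₁ z - L₂ z :=
      ((hL₁.mono (hγG 1)).comp_continuous continuous_subtype_val fun z => z.2).sub
        ((hL₂.mono (hγG (-1))).comp_continuous continuous_subtype_val fun z => z.2)
    have hone : ∀ z : G, Complex.exp (L₁ z - L₂ z) = 1 := by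
      intro z
      rw [Complex.exp_sub, hL₁e z (hγG 1 z z.2), hL₂e z (hγG (-1) z z.2), div_self]
      exact div_ne_zero
        (crossFactor_ne_zero (by simpa using hpc) fun h => hpG (OnePoint.coe_injective h ▸ z.2))
        (crossFactor_ne_zero hqc (hEG z z.2 _))
    refine ⟨L₁ c - L₂ c, fun z hz => ?_⟩
    have := eq_of_exp_eq_exp hcont (fun x y => by rw [hone, hone]) ⟨z, hz⟩ ⟨c, hc⟩
    simp only at this
    rw [← this]
    ring
  obtain ⟨k, hk⟩ := hconst
  have hexpk : Complex.exp k = 1 := by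
    have h1 := hL₁e c (hγG 1 c hc)
    rw [hk c hc, Complex.exp_add, hL₂e c (hγG (-1) c hc)] at h1
    refine mul_left_cancel₀ (div_ne_zero
      (crossFactor_ne_zero (by simpa using hpc) fun h => hpc (OnePoint.coe_injective h))
      (crossFactor_ne_zero hqc hqc)) (h1.trans (mul_one _).symm)
  have hQp : crossFactor c p q ≠ 0 := crossFactor_ne_zero hqc hqp
  have hQc : Continuous fun z => crossFactor c z q := by
    unfold crossFactor
    fun_prop
  -- a small ball on which the factor belonging to `q` has a principal logarithm
  have hev : ∀ᶠ z in 𝓝 p, z ∈ closure G ∧ q ≠ z ∧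
      crossFactor c z q / crossFactor c p q ∈ Complex.slitPlane := by
    refine (show ∀ᶠ z in 𝓝 p, z ∈ closure G from mem_interior_iff_mem_nhds.1 hp).and (.and ?_ ?_)
    · have hO : IsOpen ((fun z : ℂ => (z : OnePoint ℂ)) ⁻¹' {q}ᶜ) :=
        isOpen_compl_singleton.preimage OnePoint.continuous_coe
      filter_upwards [hO.mem_nhds (show p ∈ _ from hqp.symm)] with z hz h using hz h.symm
    · refine (hQc.div_const _).continuousAt.eventually_mem
        (Complex.isOpen_slitPlane.mem_nhds ?_)
      rw [div_self hQp]
      exact Complex.one_mem_slitPlane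
  obtain ⟨δ, hδ, hball⟩ := Metric.eventually_nhds_iff_ball.1 hev
  let V : Set ℂ := ball p δ \ {p}
  let U₁ : Set ℂ := {z | ∀ t, γ 1 t ≠ z}
  let U₂ : Set ℂ := {z | ∀ t, γ (-1) t ≠ z}
  let L : ℂ → ℂ := fun z => if z ∈ U₁ then L₁ z else L₂ z + k
  have hVo : IsOpen V := isOpen_ball.sdiff isClosed_singleton
  have hU₁o : IsOpen U₁ := isOpen_off_path _
  have hU₂o : IsOpen U₂ := isOpen_off_path _
  have hVU : ∀ z ∈ V, z ∉ U₁ → z ∈ U₂ := by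
    intro z hz h1
    refine hmeet z hz.2 (hball z hz.1).2.1 ?_
    by_contra h
    exact h1 (not_exists.1 h)
  have hLU₂ : ∀ z ∈ V, z ∈ U₂ → L z = L₂ z + k := by
    intro z hz h2
    by_cases h1 : z ∈ U₁
    · simp only [L, if_pos h1]
      exact hk z (hcover z (hball z hz.1).1 h1 h2)
    · simp only [L, if_neg h1]
  have hLc : ContinuousOn L V := by
    intro z hz
    refine ContinuousAt.continuousWithinAt ?_
    by_cases h1 : z ∈ U₁
    · refine (hL₁.continuousAt (hU₁o.mem_nhds h1)).congr ?_
      filter_upwards [hU₁o.mem_nhds h1] with w hw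
      simp only [L, if_pos hw]
    · have h2 := hVU z hz h1
      refine ((hL₂.continuousAt (hU₂o.mem_nhds h2)).add (continuousAt_const (y := k))).congr ?_
      filter_upwards [hU₂o.mem_nhds h2, hVo.mem_nhds hz] with w hw hwV
      exact (hLU₂ w hwV hw).symm
  have hLe : ∀ z ∈ V, Complex.exp (L z) = crossFactor c z p / crossFactor c z q := by
    intro z hz
    by_cases h1 : z ∈ U₁
    · simp only [L, if_pos h1]
      exact hL₁e z h1
    · have h2 := hVU z hz h1
      rw [hLU₂ z hz h2, Complex.exp_add, hexpk, mul_one]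
      exact hL₂e z h2
  refine not_exists_continuousOn_log_punctured_ball p hδ
    ⟨fun z => L z + Complex.log (crossFactor c z q / crossFactor c p q) +
      Complex.log (crossFactor c p q * (c - p)), ?_, ?_⟩
  · refine (hLc.add (ContinuousOn.clog (hQc.div_const _).continuousOn fun z hz => ?_)).add
      continuousOn_const
    exact (hball z hz.1).2.2
  · intro z hz
    have hcp : c - p ≠ 0 := sub_ne_zero.2 hpc.symm
    have hQz : crossFactor c z q ≠ 0 := crossFactor_ne_zero hqc (hball z hz.1).2.1
    rw [Complex.exp_add, Complex.exp_add, hLe z hz, Complex.exp_log (div_ne_zero hQz hQp),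
      Complex.exp_log (mul_ne_zero hQp hcp), crossFactor_coe hpc]
    field_simp

/-! ### Algebrability -/

theorem isPreconnected_punctured_ball (p : ℂ) (r : ℝ) : IsPreconnected (ball p r \ {p}) := by
  have himg : (fun x : ℝ × ℝ => p + x.1 * Complex.exp (x.2 * Complex.I)) ''
      (Set.Ioo 0 r ×ˢ Set.univ) = ball p r \ {p} := by
    ext z
    constructor
    · rintro ⟨⟨ρ, θ⟩, ⟨hρ, -⟩, rfl⟩
      have hn : ‖(ρ : ℂ) * Complex.exp (θ * Complex.I)‖ = ρ := by
        simp [Complex.norm_exp_ofReal_mul_I, abs_of_pos hρ.1]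
      refine ⟨by rw [mem_ball_iff_norm, add_sub_cancel_left, hn]; exact hρ.2, fun h => ?_⟩
      rw [Set.mem_singleton_iff, add_eq_left] at h
      simp only [h, norm_zero] at hn
      exact hρ.1.ne hn
    · rintro ⟨hz, hzp⟩
      refine ⟨(‖z - p‖, (z - p).arg), ⟨⟨norm_pos_iff.2 (sub_ne_zero.2 hzp), ?_⟩, trivial⟩, ?_⟩
      · exact mem_ball_iff_norm.1 hz
      · simp [Complex.norm_mul_exp_arg_mul_I]
  rw [← himg]
  exact (isPreconnected_Ioo.prod isPreconnected_univ).image _ (by fun_prop)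

/-- An isolated boundary point of an open set is interior to its closure, as a punctured disc
about it is connected. -/
theorem accPt_frontier_of_notMem_interior_closure {C : Set ℂ} (hC : IsOpen C) {z : ℂ}
    (hz : z ∈ frontier C) (hzi : z ∉ interior (closure C)) : AccPt z (𝓟 (frontier C)) := by
  by_contra hacc
  rw [accPt_iff_frequently_nhdsNE, not_frequently, eventually_nhdsWithin_iff] at hacc
  obtain ⟨r, hr, hball⟩ := Metric.eventually_nhds_iff_ball.1 hacc
  rw [hC.frontier_eq] at hz
  have hsub : ball z r \ {z} ⊆ C := by
    obtain ⟨x, hxb, hxC⟩ := mem_closure_iff_nhds.1 hz.1 _ (ball_mem_nhds z hr)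
    by_contra h
    obtain ⟨y, hyf, hy⟩ := frontier_inter_nonempty_of_not_subset hC
      (isPreconnected_punctured_ball z r) ⟨x, ⟨hxb, fun h => hz.2 (h ▸ hxC)⟩, hxC⟩ h
    exact hball y hy.1 hy.2 hyf
  refine hzi (mem_interior_iff_mem_nhds.2 (mem_of_superset (ball_mem_nhds z hr) fun y hy => ?_))
  by_cases hyz : y = z
  · exact hyz ▸ hz.1
  · exact subset_closure (hsub ⟨hy, hyz⟩)

theorem mem_holo_of_eqOn {G : Set ℂ} {f : G → ℂ} {u : ℂ → ℂ}
    (hu : DifferentiableOn ℂ u G) (h : ∀ z (hz : z ∈ G), f ⟨z, hz⟩ = u z) : f ∈ holo G :=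
  hu.congr fun z hz => by rw [zeroExt_apply f hz, h z hz]

theorem holoExact_subset_holoWeaklyExact {G : Set ℂ} (hG : IsDomainC G) :
    holoExact G ⊆ holoWeaklyExact G := by
  rintro f ⟨hf, hno⟩
  refine ⟨hf, ?_⟩
  rintro ⟨D, hD, hGD, F, hF, hFf⟩
  exact hno ⟨D, G, hD, hG, fun z hz => ⟨hz, hGD.1 hz⟩, hGD.2, F, hF,
    fun z hz hz₁ _ => hFf z hz hz₁⟩

theorem zero_notMem_holoWeaklyExact {G : Set ℂ} (hne : G ≠ Set.univ) :
    (0 : G → ℂ) ∉ holoWeaklyExact G := by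
  rintro ⟨-, hno⟩
  exact hno ⟨Set.univ, ⟨isOpen_univ, isConnected_univ⟩, Set.ssubset_univ_iff.2 hne, 0,
    mem_holo_of_eqOn (u := 0) (differentiableOn_const 0) fun _ _ => rfl,
    fun _ _ _ => rfl⟩

theorem StronglyAlgebrable.mono {R : Type*} [CommRing R] [Algebra ℂ R] {α : Cardinal}
    {S T : Set R} (h : StronglyAlgebrable α S) (hST : S ⊆ T) : StronglyAlgebrable α T := by
  obtain ⟨M, B, hB, hM, hfree, hsub⟩ := h
  exact ⟨M, B, hB, hM, hfree, hsub.trans hST⟩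

/-- If `f` does not extend to a domain larger than `G`, then neither does `φ ∘ f`: an extension of
`φ ∘ f` yields one of `f` to the union of `G` and a disc centred on its boundary. -/
theorem comp_mem_holoWeaklyExact {G : Set ℂ} (hG : IsDomainC G)
    (hperf : Preperfect (frontier G)) {f : G → ℂ} (hf : f ∈ holoWeaklyExact G)
    (hf1 : f ∈ boundaryRegular 1 G) {φ : ℂ → ℂ} (hφ : Differentiable ℂ φ)
    (hφc : ¬ ∃ c, ∀ z, φ z = c) : φ ∘ f ∈ holoWeaklyExact G := by
  classical
  refine ⟨comp_mem_holo hf.1 hφ, ?_⟩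
  rintro ⟨D, hD, hGD, F, hF, hFf⟩
  obtain ⟨u₀, hu₀, hu₀u⟩ := hf1.2 0 (by simp)
  obtain ⟨u₁, hu₁, hu₁u⟩ := hf1.2 1 (by simp)
  simp only [iteratedDeriv_zero] at hu₀u
  simp only [iteratedDeriv_one] at hu₁u
  obtain ⟨z₀, hz₀, r, hr, v, hv, -, hvu⟩ := exists_local_extension hG hD hGD.1 hGD.2 hf.1 hu₀ hu₀u
    hu₁ hu₁u (fun z hz => hperf z hz.1) hφ hφc hF fun z hz => by
      rw [zeroExt_apply F (hGD.1 hz), hFf z hz, zeroExt_apply f hz, Function.comp]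
  rw [hG.1.frontier_eq] at hz₀
  let w : ℂ → ℂ := fun z => if z ∈ G then zeroExt f z else v z
  have hwG : ∀ z ∈ G, w z = zeroExt f z := fun z hz => if_pos hz
  have hwv : ∀ z ∈ ball z₀ r, w z = v z := by
    intro z hz
    by_cases hzG : z ∈ G
    · rw [hwG z hzG, hvu z ⟨hzG, hz⟩]
    · exact if_neg hzG
  have hw : DifferentiableOn ℂ w (G ∪ ball z₀ r) :=
    (DifferentiableOn.congr hf.1 hwG).union_of_isOpen (hv.congr hwv) hG.1 isOpen_ball
  obtain ⟨x, hxb, hxG⟩ := mem_closure_iff_nhds.1 hz₀.1 _ (ball_mem_nhds z₀ hr)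
  refine hf.2 ⟨G ∪ ball z₀ r, ⟨hG.1.union isOpen_ball, ?_⟩,
    ⟨Set.subset_union_left, fun h => hz₀.2 (h (Or.inr (mem_ball_self hr)))⟩,
    fun z => w z, mem_holo_of_eqOn hw fun _ _ => rfl, fun z hz _ => ?_⟩
  · exact hG.2.union ⟨x, hxG, hxb⟩ (isConnected_ball hr)
  · rw [← zeroExt_apply f hz]
    exact hwG z hz

/-- A function whose Taylor coefficients are unbounded in the sense of
`exists_boundaryRegular_taylor_unbounded` does not continue holomorphically to a disc about a
boundary point, even if agreement is required only on an open part `C` of the domain adhering to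
that point. -/
theorem not_exists_extension_of_taylor_unbounded {G : Set ℂ} (hG : IsRegularDomain G)
    {u : ℂ → ℂ} {S : Set ℂ} (hS : G ⊆ closure S)
    (hunb : ∀ p ∈ S, ∀ R : ℚ, ¬ ball p R ⊆ closure G → ∀ M : ℝ,
        ∃ j : ℕ, M < ‖iteratedDeriv j u p‖ / j.factorial * (R : ℝ) ^ j)
    {C : Set ℂ} (hC : IsOpen C) (hCG : C ⊆ G) {z₀ : ℂ} (hz₀ : z₀ ∈ closure C) (hz₀G : z₀ ∉ G)
    {r : ℝ} (hr : 0 < r) :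
    ¬ ∃ v : ℂ → ℂ, DifferentiableOn ℂ v (ball z₀ r) ∧ ∀ z ∈ C ∩ ball z₀ r, v z = u z := by
  rintro ⟨v, hv, hvu⟩
  have hr4 : 0 < r / 4 := by linarith
  obtain ⟨x, hxb, hxC⟩ := mem_closure_iff_nhds.1 hz₀ _ (ball_mem_nhds z₀ hr4)
  obtain ⟨p, ⟨hpC, hpb⟩, hpS⟩ := mem_closure_iff_nhds.1 (hS (hCG hxC)) (C ∩ ball z₀ (r / 4))
    ((hC.inter isOpen_ball).mem_nhds ⟨hxC, hxb⟩)
  -- the disc of radius `R` about `p` contains `z₀` and stays inside the disc where `v` lives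
  obtain ⟨R, hR1, hR2⟩ := exists_rat_btwn (show r / 4 < r / 2 by linarith)
  have hR0 : (0 : ℝ) < R := hr4.trans hR1
  have hpz : dist p z₀ < r / 4 := hpb
  have hsub : closedBall p R ⊆ ball z₀ r := fun y hy => by
    have h1 : dist y p ≤ R := hy
    have h2 := dist_triangle y p z₀
    rw [mem_ball]
    linarith
  have hnot : ¬ ball p R ⊆ closure G := by
    intro h
    refine hz₀G (hG.2 ▸ mem_interior.2 ⟨_, h, isOpen_ball, ?_⟩)
    rw [mem_ball, dist_comm]
    linarith
  obtain ⟨M, hM⟩ := (isCompact_sphere p R).exists_bound_of_continuousOn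
    (hv.continuousOn.mono (sphere_subset_closedBall.trans hsub))
  obtain ⟨j, hj⟩ := hunb p hpS R hnot M
  have hcauchy := Complex.norm_iteratedDeriv_le_of_forall_mem_sphere_norm_le j hR0
    (hv.mono (closure_ball_subset_closedBall.trans hsub)).diffContOnCl hM
  have heq : iteratedDeriv j v p = iteratedDeriv j u p := by
    refine Filter.EventuallyEq.iteratedDeriv_eq j ?_
    filter_upwards [(hC.inter isOpen_ball).mem_nhds
      ⟨hpC, hsub (mem_closedBall_self hR0.le)⟩] with y hy using hvu y hy
  rw [heq] at hcauchy
  have hfac : (0 : ℝ) < j.factorial := by positivity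
  have hpow : (0 : ℝ) < (R : ℝ) ^ j := by positivity
  rw [le_div_iff₀ hpow] at hcauchy
  rw [div_mul_eq_mul_div, lt_div_iff₀ hfac] at hj
  linarith

/-- On a regular domain even the functions without any extension in the strong sense, smooth up to
the boundary, contain a free algebra. Here an extension of `φ ∘ f` along a part of `G` is
analysed on a component `C` of `G ∩ G₁`; regularity of `G` prevents isolated points of
`∂C` inside `G₁`. -/
theorem IsRegularDomain.stronglyAlgebrable_holoExact {G : Set ℂ} (hG : IsRegularDomain G)
    (hne : G ≠ Set.univ) : StronglyAlgebrable 𝔠 (holoExact G ∩ boundaryRegular ⊤ G) := by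
  obtain ⟨u, S, hu, hext, -, hS, hunb⟩ := exists_boundaryRegular_taylor_unbounded hG hne
  have hGo := hG.1.1
  let f : G → ℂ := fun z => u z
  have hfu : ∀ z ∈ G, zeroExt f z = u z := fun z hz => zeroExt_apply f hz
  have hf : f ∈ holo G := mem_holo_of_eqOn hu fun _ _ => rfl
  have hfr : f ∈ boundaryRegular ⊤ G :=
    ⟨hf, fun j _ => (hext j).congr hGo (fun z hz => (hfu z hz).symm) j le_rfl⟩
  refine stronglyAlgebrable_of_comp_mem
    (fun h => zero_notMem_holoWeaklyExact hne (holoExact_subset_holoWeaklyExact hG.1 h.1)) f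
    fun φ hφ hφc => ⟨⟨comp_mem_holo hf hφ, ?_⟩, comp_mem_boundaryRegular_top hGo hfr hφ⟩
  rintro ⟨G₁, G₂, hG₁, hG₂, hsub, hG₁G, F, hF, hFf⟩
  obtain ⟨x, hx⟩ := hG₂.2.nonempty
  let C := connectedComponentIn (G ∩ G₁) x
  have hCo : IsOpen C := (hGo.inter hG₁.1).connectedComponentIn
  have hCsub : C ⊆ G ∩ G₁ := connectedComponentIn_subset _ _
  have hxC : x ∈ C := mem_connectedComponentIn (hsub hx)
  have hC : IsDomainC C := ⟨hCo, ⟨⟨x, hxC⟩, isPreconnected_connectedComponentIn⟩⟩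
  -- a component of `G ∩ G₁` is relatively closed, so its frontier leaves `G` inside `G₁`
  have hfrontier : ∀ z ∈ frontier C ∩ G₁, z ∉ G := by
    rintro z ⟨hz, hzG₁⟩ hzG
    rw [hCo.frontier_eq] at hz
    have hO : IsOpen (connectedComponentIn (G ∩ G₁) z) := (hGo.inter hG₁.1).connectedComponentIn
    have hzO : z ∈ connectedComponentIn (G ∩ G₁) z := mem_connectedComponentIn ⟨hzG, hzG₁⟩
    obtain ⟨y, hyO, hyC⟩ := mem_closure_iff_nhds.1 hz.1 _ (hO.mem_nhds hzO)
    refine hz.2 ?_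
    change z ∈ connectedComponentIn (G ∩ G₁) x
    rwa [connectedComponentIn_eq hyC, ← connectedComponentIn_eq hyO]
  have hFC : ∀ z ∈ C, zeroExt F z = φ (u z) := by
    have h1 : AnalyticOnNhd ℂ (zeroExt F) C :=
      (DifferentiableOn.mono hF (hCsub.trans Set.inter_subset_right)).analyticOnNhd hCo
    have h2 : AnalyticOnNhd ℂ (fun z => φ (u z)) C :=
      (hφ.comp_differentiableOn (hu.mono (hCsub.trans Set.inter_subset_left))).analyticOnNhd hCo
    refine h1.eqOn_of_preconnected_of_eventuallyEq h2 hC.2.isPreconnected hxC ?_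
    filter_upwards [hG₂.1.mem_nhds hx] with z hz
    rw [zeroExt_apply F (hsub hz).2, hFf z (hsub hz).1 _ hz]
    rfl
  obtain ⟨u₀, hu₀, hu₀u⟩ := hext 1 0 (by simp)
  obtain ⟨u₁, hu₁, hu₁u⟩ := hext 1 1 le_rfl
  simp only [iteratedDeriv_zero] at hu₀u
  simp only [iteratedDeriv_one] at hu₁u
  have hCG : C ⊆ G := hCsub.trans Set.inter_subset_left
  obtain ⟨z₀, hz₀, r, hr, v, hv, hball, hvu⟩ := exists_local_extension hC hG₁
    (hCsub.trans Set.inter_subset_right) (fun h => hG₁G (h.trans hCG)) (hu.mono hCG)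
    (hu₀.mono (closure_mono hCG)) (fun z hz => hu₀u z (hCG hz))
    (hu₁.mono (closure_mono hCG)) (fun z hz => hu₁u z (hCG hz))
    (fun z hz => accPt_frontier_of_notMem_interior_closure hCo hz.1 fun hzi =>
      hfrontier z hz (hG.2 ▸ interior_mono (closure_mono hCG) hzi)) hφ hφc hF hFC
  exact not_exists_extension_of_taylor_unbounded hG hS hunb hCo hCG (frontier_subset_closure hz₀)
    (hfrontier z₀ ⟨hz₀, hball (mem_ball_self hr)⟩) hr ⟨v, hv, hvu⟩

theorem mainTheorem4 (G : Set ℂ) (hG : IsDomainC G) (hne : G ≠ Set.univ) :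
    (Preperfect (frontier G) →
      ∀ X : NonUnitalSubalgebra ℂ (G → ℂ),
        (X : Set (G → ℂ)) ⊆ boundaryRegular 1 G →
        (∀ f ∈ X, ∀ φ : ℂ → ℂ, Differentiable ℂ φ → φ ∘ f ∈ X) →
        holoWeaklyExact G ∩ (X : Set (G → ℂ)) = ∅ ∨
          StronglyAlgebrable 𝔠 (holoWeaklyExact G ∩ (X : Set (G → ℂ)))) ∧
    (IsRegularDomain G →
      StronglyAlgebrable 𝔠 (holoWeaklyExact G ∩ boundaryRegular ⊤ G)) ∧
    (IsJordanDomain G →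
      StronglyAlgebrable 𝔠 (holoExact G ∩ boundaryRegular ⊤ G)) := by
  refine ⟨fun hperf X hX hcomp => ?_, fun hreg => ?_, fun hJ =>
    hJ.isRegularDomain.stronglyAlgebrable_holoExact hne⟩
  · rcases Set.eq_empty_or_nonempty (holoWeaklyExact G ∩ (X : Set (G → ℂ))) with h | ⟨f, hf, hfX⟩
    · exact Or.inl h
    · exact Or.inr (stronglyAlgebrable_of_comp_mem
        (fun h => zero_notMem_holoWeaklyExact hne h.1) f fun φ hφ hφc =>
          ⟨comp_mem_holoWeaklyExact hG hperf hf (hX hfX) hφ hφc, hcomp f hfX φ hφ⟩)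
  · exact (hreg.stronglyAlgebrable_holoExact hne).mono
      (Set.inter_subset_inter_left _ (holoExact_subset_holoWeaklyExact hG))
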